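/- **Setting.** Let $\mathcal V$ and $E$ be countable sets. A metric graph $\mathcal G$ is given by maps $i,j:E\to\mathcal V$ (initial and final vertex of an edge) and lengths $l_e\in(0,\infty)$, $e\in E$; its points are the vertices together with the interior points $(e,t)$, $0<t<l_e$, of the edges. Write $I_e=(0,l_e)$, $\mathcal G_e=\{e\}\times I_e$, and identify the endpoints $0,l_e$ of $\overline I_e$ with $i(e),j(e)$. For $f:\mathcal G\to\mathbb R$ let $f_e:\overline I_e\to\mathbb R$ be its restriction to the closed edge $e$. Write $e\ni v$ if $v\in\{i(e),j(e)\}$, and $x\sim y$ if some edge joins $x$ and $y$. The distance $d(x,y)$ is the infimum of the lengths of the paths in $\mathcal G$ from $x$ to $y$. Let $\mu_{\mathcal V}:\mathcal V\to(0,\infty)$ be a vertex measure and let $\omega(x,y)=\omega(y,x)>0$ be weights on pairs of adjacent vertices. Let $\mathcal D(\mathcal G)$ be the set of continuous $f:\mathcal G\to\mathbb R$ with $f_e\in C^2(I_e)\cap C^1(\overline I_e)$ and $f_e''\in L^\infty(I_e)$ for all $e$. Put $$\Delta_{\mathcal V}f(x)=\frac1{\mu_{\mathcal V}(x)}\sum_{y\sim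 x}\omega(x,y)\,(f(y)-f(x)),\qquad [\mathcal K(f)](x)=\sum_{e\ni x}\frac{df_e(x)}{dn}\qquad(x\in\mathcal V),$$ where $\frac{df_e(x)}{dn}=f_e'(l_e)$ if $j(e)=x$ and $\frac{df_e(x)}{dn}=-f_e'(0)$ if $i(e)=x$ (one-sided derivatives). Let $\sigma>1$ and $V:\mathcal G\to(0,\infty)$. A solution of $\Delta_{\mathcal G}u+V|u|^\sigma\le0$ is a function $u\in\mathcal D(\mathcal G)$ such that $u_e''+V_e|u_e|^\sigma\le0$ on $(0,l_e)$ for every edge $e$, and $\Delta_{\mathcal V}u(x)+V(x)|u(x)|^\sigma\le0$ and $[\mathcal K(u)](x)=0$ for every $x\in\mathcal V$. **Theorem 3.1.** Let $x_0\in\mathcal V$ and assume: (i) $\mathcal G$ is infinite ($\mathcal V$ or $E$ is infinite), connected and locally finite (every vertex is an endpoint of finitely many edges); (ii) there are no loops: $i(e)\ne j(e)$ for all $e$; (iii) there are vertices $x_n$ with $d(x_n,x_0)\to\infty$; (iv) for every $R>0$ the ball $\{x\in\mathcal G: d(x,x_0)<R\}$ contains finitely many vertices and meets finitely many edges; (v)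 there is $C>0$ with $\sum_{y\sim x}\omega(x,y)\le C\mu_{\mathcal V}(x)$ for all $x\in\mathcal V$; (vi) $j:=\sup_e l_e<\infty$ and $r:=\inf_e l_e>0$. For $R>0$ let $E_R=\{x\in\mathcal G: R\le d(x,x_0)\le 2R\}$. Suppose that there is $C>0$ such that for every $R\ge R_0:=\max\{2j,1\}$ $$\sum_{x\in E_R\cap\mathcal V}\mu_{\mathcal V}(x)V(x)^{-\frac1{\sigma-1}}\le CR^{\frac{\sigma}{\sigma-1}},\qquad \sum_{e\in E:\ \mathcal G_e\subset E_R}\int_0^{l_e}V_e(x)^{-\frac1{\sigma-1}}\,dx\le CR^{\frac{\sigma}{\sigma-1}}.$$ If $u$ is a solution of $\Delta_{\mathcal G}u+V|u|^\sigma\le0$ with $u\ge0$ on $\mathcal G$, then $u\equiv0$ on $\mathcal G$. -/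

import Mathlib

open Set Filter MeasureTheory
open scoped ENNReal

noncomputable section

/-- Combinatorial data of a metric graph with vertex set `V` and edge set `E`: every edge has an
initial vertex, a final vertex and a finite positive length. Loops and parallel edges are allowed
at this stage. -/
structure MetricGraph (V E : Type*) where
  init : E → V
  final : E → V
  len : E → ℝ
  len_pos : ∀ e, 0 < len e

namespace MetricGraph

variable {V E : Type*} (G : MetricGraph V E)

/-- The points of the metric graph: the vertices, and the interior points `(e, t)`,
`0 < t < len e`, of the edges. -/
inductive Point (G : MetricGraph V E) where
  | vertex (v : V) : Point G
  | inner (e : E) (t : Ioo (0 : ℝ) (G.len e)) : Point G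

open Classical in
/-- The point with coordinate `t ∈ [0, len e]` on the closed edge `e`; the coordinate `0` belongs to
the initial vertex and `len e` to the final vertex. (Coordinates outside `[0, len e]` are
clamped.) -/
def pt (e : E) (t : ℝ) : G.Point :=
  if h : t ∈ Ioo (0 : ℝ) (G.len e) then Point.inner e ⟨t, h⟩
  else if t ≤ 0 then Point.vertex (G.init e) else Point.vertex (G.final e)

/-- `e ∋ v`: the vertex `v` is an endpoint of the edge `e`. -/
def Incident (e : E) (v : V) : Prop := G.init e = v ∨ G.final e = v

/-- Two vertices are adjacent if some edge joins them. -/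
def Adj (x y : V) : Prop :=
  ∃ e, (G.init e = x ∧ G.final e = y) ∨ (G.init e = y ∧ G.final e = x)

/-- `G.IsPath x y L`: there is a path `x = x₁, …, xₙ = y` of points, any two consecutive ones lying
on a common closed edge, such that the segments between consecutive points have total
length `L`. -/
inductive IsPath (G : MetricGraph V E) : G.Point → G.Point → ℝ → Prop
  | nil (x : G.Point) : IsPath G x x 0
  | cons (e : E) (s t : ℝ) (hs : s ∈ Icc 0 (G.len e)) (ht : t ∈ Icc 0 (G.len e))
      (y : G.Point) (L : ℝ) (h : IsPath G (G.pt e t) y L) : IsPath G (G.pt e s) y (|s - t| + L)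

/-- The path distance: infimum of the lengths of the paths from `x` to `y`. -/
def dist (x y : G.Point) : ℝ := sInf {L : ℝ | G.IsPath x y L}

/-- Any two distinct vertices are joined by a path. -/
def IsConnected : Prop :=
  ∀ v w : V, v ≠ w → ∃ L, G.IsPath (Point.vertex v) (Point.vertex w) L

/-- Every vertex is an endpoint of finitely many edges only. -/
def IsLocallyFinite : Prop := ∀ v : V, {e | G.Incident e v}.Finite

/-- The annulus `{x : R ≤ d(x, x₀) ≤ 2R}`. -/
def annulus (x₀ : V) (R : ℝ) : Set G.Point :=
  {x | R ≤ G.dist x (Point.vertex x₀) ∧ G.dist x (Point.vertex x₀) ≤ 2 * R}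

/-- The restriction `f_e` of `f` to the closed edge `e`, as a function of the coordinate in
`[0, len e]`. The values at the endpoints are those of `f` at the vertices, so the restrictions to
different edges automatically agree at common endpoints. -/
def onEdge (f : G.Point → ℝ) (e : E) : ℝ → ℝ := fun t => f (G.pt e t)

/-- The regularity class `𝒟(G)`: on every edge, `f_e` is `C¹` on the closed interval (in particular
continuous up to the endpoints, so `f` is continuous on `G`), `C²` on the open interval, and its
second derivative is in `L^∞`. -/
structure MemD (f : G.Point → ℝ) : Prop where
  contDiffOn_one : ∀ e, ContDiffOn ℝ 1 (G.onEdge f e) (Icc 0 (G.len e))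
  contDiffOn_two : ∀ e, ContDiffOn ℝ 2 (G.onEdge f e) (Ioo 0 (G.len e))
  memLp_top : ∀ e, MemLp (deriv (deriv (G.onEdge f e))) ∞ (volume.restrict (Ioo 0 (G.len e)))

open Classical in
/-- The outer normal derivative of `f_e` at the endpoint `v` of `e` (one-sided derivatives). -/
def outerNormalDeriv (f : G.Point → ℝ) (e : E) (v : V) : ℝ :=
  if G.final e = v then derivWithin (G.onEdge f e) (Icc 0 (G.len e)) (G.len e)
  else if G.init e = v then -derivWithin (G.onEdge f e) (Icc 0 (G.len e)) 0
  else 0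

/-- `[𝒦(f)](v)`, the sum of the outer normal derivatives of `f` at `v` over all edges `e ∋ v`. -/
def kirchhoff (f : G.Point → ℝ) (v : V) : ℝ :=
  ∑ᶠ e ∈ {e | G.Incident e v}, G.outerNormalDeriv f e v

end MetricGraph

/-- A metric graph with a positive vertex measure `μ` and a positive symmetric weight `ω` on the
pairs of adjacent vertices. -/
structure WeightedMetricGraph (V E : Type*) extends MetricGraph V E where
  μ : V → ℝ
  μ_pos : ∀ v, 0 < μ v
  ω : V → V → ℝ
  ω_pos : ∀ x y, toMetricGraph.Adj x y → 0 < ω x y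
  ω_symm : ∀ x y, toMetricGraph.Adj x y → ω x y = ω y x

namespace WeightedMetricGraph

open MetricGraph

variable {V E : Type*} (G : WeightedMetricGraph V E)

/-- The vertex Laplacian
`Δ_V f(x) = (1 / μ(x)) ∑_{y ∼ x} ω(x, y) (f(y) - f(x))`. -/
def vertexLaplacian (f : G.Point → ℝ) (x : V) : ℝ :=
  (1 / G.μ x) * ∑ᶠ y ∈ {y | G.Adj x y}, G.ω x y * (f (Point.vertex y) - f (Point.vertex x))

/-- `u` is a solution of `Δ_G u + P |u|^σ ≤ 0`: it belongs to `𝒟(G)`, satisfies the inequality on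
every open edge (with the second derivative) and at every vertex (with the vertex Laplacian), and
satisfies the Kirchhoff-Neumann condition at every vertex. -/
structure IsSolution (P : G.Point → ℝ) (σ : ℝ) (u : G.Point → ℝ) : Prop where
  memD : G.MemD u
  edge_le : ∀ e, ∀ t ∈ Ioo 0 (G.len e),
    deriv (deriv (G.onEdge u e)) t + G.onEdge P e t * |G.onEdge u e t| ^ σ ≤ 0
  vertex_le : ∀ x, G.vertexLaplacian u x + P (Point.vertex x) * |u (Point.vertex x)| ^ σ ≤ 0
  kirchhoff_eq : ∀ x, G.kirchhoff u x = 0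

/-- The standing hypotheses on the graph, with base vertex `x₀`. -/
structure StandingHyp (x₀ : V) : Prop where
  infinite : Infinite V ∨ Infinite E
  connected : G.IsConnected
  locallyFinite : G.IsLocallyFinite
  no_loops : ∀ e, G.init e ≠ G.final e
  unbounded : ∃ x : ℕ → V,
    Tendsto (fun n => G.dist (Point.vertex (x n)) (Point.vertex x₀)) atTop atTop
  ball_vertices_finite : ∀ R > 0,
    {v : V | G.dist (Point.vertex v) (Point.vertex x₀) < R}.Finite
  ball_edges_finite : ∀ R > 0,
    {e : E | ∃ t, G.dist (Point.inner e t) (Point.vertex x₀) < R}.Finite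
  weight_le : ∃ C > 0, ∀ x, ∑ᶠ y ∈ {y | G.Adj x y}, G.ω x y ≤ C * G.μ x
  len_bddAbove : BddAbove (range G.len)
  len_iInf_pos : 0 < ⨅ e, G.len e

end WeightedMetricGraph

end

/-!
The vertex inequality alone forces `u` to vanish at the vertices, and the edge inequality then only
enters through concavity.

At the vertices, put `s = σ / (σ - 1)` and test `Δ_V u + P u ^ σ ≤ 0` with `μ φ ^ s`, where `φ` is a
radial cutoff equal to `1` for `d ≤ R` and to `0` for `d ≥ 2R`. By symmetry of the weights the
Laplacian moves to `φ ^ s`. Convexity gives `φ(x) ^ s - φ(y) ^ s ≤ s φ(x) ^ (s - 1) (φ(x) - φ(y))` when `φ`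
decreases from `x` to `y`, edge lengths are bounded and `∑ ω ≤ C μ`; hence
`-Δ_V (φ ^ s) ≤ (K / R) φ ^ (s - 1)`, supported in the annulus `R ≤ d ≤ 2R`. Since `s - 1 = s / σ`,
Hölder's inequality and the growth assumption give
`∑ μ P u ^ σ φ ^ s ≤ K (∑_{annulus} μ P u ^ σ φ ^ s) ^ (1 / σ)` with `K` independent of `R`
(`annulus_estimate`). This bounds the left-hand side, so `∑ μ P u ^ σ` converges, so the right-hand
side tends to `0` as `R → ∞`, and `u = 0` at every vertex (`eq_zero_of_superharmonic`).

On an edge `u` is concave and now zero at both ends, so its outer normal derivatives are `≤ 0`. The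
Kirchhoff condition makes them all vanish, and a concave function with `u = u' = 0` at an endpoint is
`≤ 0` (`WeightedMetricGraph.IsSolution.onEdge_eq_zero`); together with `u ≥ 0` this is the claim.
-/

/-! ### Elementary inequalities and summation by parts -/

/-- The tangent-line inequality for the convex function `a ↦ a ^ s`; it is Bernoulli's inequality
after dividing by `a ^ s`. -/
theorem rpow_sub_rpow_le {s a b : ℝ} (hs : 1 ≤ s) (hb : 0 ≤ b) (hab : b ≤ a) :
    a ^ s - b ^ s ≤ s * a ^ (s - 1) * (a - b) := by
  rcases (hb.trans hab).eq_or_lt with h | ha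
  · have hb0 : b = 0 := le_antisymm (hab.trans h.ge) hb
    simp [← h, hb0]
  have h1 := one_add_mul_self_le_rpow_one_add (s := b / a - 1) (by
    have := div_nonneg hb ha.le
    linarith) hs
  rw [add_sub_cancel, Real.div_rpow hb ha.le, le_div_iff₀ (Real.rpow_pos_of_pos ha s)] at h1
  have h2 : a ^ s = a ^ (s - 1) * a := by
    rw [Real.rpow_sub_one ha.ne']; field_simp
  have h3 : (1 + s * (b / a - 1)) * (a ^ (s - 1) * a) =
      a ^ (s - 1) * a - s * a ^ (s - 1) * (a - b) := by
    field_simp; ring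
  rw [h2, h3, ← h2] at h1
  linarith

/-- Symmetry of the weighted graph Laplacian on a finite set. -/
theorem sum_sum_mul_sub_eq {V : Type*} (b : V → V → ℝ) (hsymm : ∀ x y, b x y = b y x)
    (w φ : V → ℝ) (T : Finset V) :
    ∑ x ∈ T, φ x * ∑ y ∈ T, b x y * (w y - w x) = ∑ x ∈ T, w x * ∑ y ∈ T, b x y * (φ y - φ x) := by
  have h : ∑ x ∈ T, ∑ y ∈ T, φ x * b x y * w y = ∑ x ∈ T, ∑ y ∈ T, w x * b x y * φ y := by
    rw [Finset.sum_comm]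
    refine Finset.sum_congr rfl fun x _ => Finset.sum_congr rfl fun y _ => ?_
    rw [hsymm y x]; ring
  have e1 : ∀ f g : V → ℝ, ∑ x ∈ T, f x * ∑ y ∈ T, b x y * (g y - g x)
      = ∑ x ∈ T, ∑ y ∈ T, f x * b x y * g y - ∑ x ∈ T, ∑ y ∈ T, f x * g x * b x y := by
    intro f g
    simp only [Finset.mul_sum, ← Finset.sum_sub_distrib]
    refine Finset.sum_congr rfl fun x _ => Finset.sum_congr rfl fun y _ => ?_
    ring
  rw [e1, e1, h]
  simp only [mul_comm (φ _) (w _)]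

/-- Testing a supersolution against a nonnegative function `φ` of finite support. The finite set `T`
only has to contain the neighbours of the support, since the inequality is not used elsewhere. -/
theorem sum_test_le {V : Type*} (b : V → V → ℝ) (hsymm : ∀ x y, b x y = b y x)
    (w a φ : V → ℝ) (hφ : ∀ x, 0 ≤ φ x)
    (hw : ∀ x, ∑ᶠ y, b x y * (w y - w x) + a x ≤ 0) (T : Finset V)
    (hT : ∀ x y, φ x ≠ 0 → b x y ≠ 0 → y ∈ T) :
    ∑ x ∈ T, a x * φ x ≤ ∑ x ∈ T, w x * ∑ y ∈ T, b x y * (φ x - φ y) := by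
  have h1 : ∑ x ∈ T, a x * φ x ≤ -∑ x ∈ T, φ x * ∑ y ∈ T, b x y * (w y - w x) := by
    rw [← Finset.sum_neg_distrib]
    refine Finset.sum_le_sum fun x _ => ?_
    rcases eq_or_ne (φ x) 0 with h0 | h0
    · simp [h0]
    have h2 : ∑ᶠ y, b x y * (w y - w x) = ∑ y ∈ T, b x y * (w y - w x) := by
      refine finsum_eq_sum_of_support_subset _ fun y hy => ?_
      exact hT x y h0 (left_ne_zero_of_mul hy)
    have h3 := hw x
    rw [h2] at h3
    nlinarith [hφ x]
  refine h1.trans_eq ?_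
  rw [sum_sum_mul_sub_eq b hsymm, ← Finset.sum_neg_distrib]
  refine Finset.sum_congr rfl fun x _ => ?_
  rw [← mul_neg, ← Finset.sum_neg_distrib]
  congr 1
  refine Finset.sum_congr rfl fun y _ => ?_
  ring

/-! ### The radial cutoff -/

/-- The radial cutoff with value `1` for `t ≤ R + J`, value `0` for `t ≥ 2R - J`, and affine in
between. The margin `J` will bound the change of the distance to the base vertex along an edge,
so that only vertices of the annulus `R ≤ t ≤ 2R` see the cutoff decrease. -/
noncomputable def cutoff (J R t : ℝ) : ℝ := max 0 (min 1 ((2 * R - J - t) / (R - 2 * J)))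

section Cutoff

variable {J R : ℝ}

theorem cutoff_nonneg (t : ℝ) : 0 ≤ cutoff J R t := le_max_left _ _

theorem cutoff_le_one (t : ℝ) : cutoff J R t ≤ 1 := max_le zero_le_one (min_le_left _ _)

theorem cutoff_eq_one (hR : 2 * J < R) {t : ℝ} (ht : t ≤ R + J) : cutoff J R t = 1 := by
  have : 1 ≤ (2 * R - J - t) / (R - 2 * J) := by
    rw [le_div_iff₀ (by linarith)]; linarith
  simp [cutoff, min_eq_left this]

theorem cutoff_eq_zero (hR : 2 * J < R) {t : ℝ} (ht : 2 * R - J ≤ t) : cutoff J R t = 0 := by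
  have : (2 * R - J - t) / (R - 2 * J) ≤ 0 :=
    div_nonpos_of_nonpos_of_nonneg (by linarith) (by linarith)
  exact max_eq_left ((min_le_right _ _).trans this)

theorem cutoff_sub_le (hJ : 0 < J) (hR : 4 * J ≤ R) {t t' : ℝ} (h : t' ≤ t + J) :
    cutoff J R t - cutoff J R t' ≤ 2 * J / R := by
  have hp : 0 < R - 2 * J := by linarith
  have h1 : (2 * R - J - t) / (R - 2 * J) ≤ (2 * R - J - t') / (R - 2 * J) + 2 * J / R := by
    have h2 : (2 * R - J - t) / (R - 2 * J) - (2 * R - J - t') / (R - 2 * J) ≤ J / (R - 2 * J) := by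
      rw [← sub_div]; gcongr; linarith
    have h3 : J / (R - 2 * J) ≤ 2 * J / R := by
      rw [div_le_div_iff₀ hp (by linarith)]; nlinarith
    linarith
  have h0 : 0 ≤ 2 * J / R := div_nonneg (by linarith) (by linarith)
  unfold cutoff
  rw [sub_le_iff_le_add]
  refine max_le (add_nonneg h0 (le_max_left _ _)) ?_
  rw [← sub_le_iff_le_add']
  refine le_max_of_le_right (le_min ?_ ?_)
  · have := min_le_left 1 ((2 * R - J - t) / (R - 2 * J)); linarith
  · have := min_le_right 1 ((2 * R - J - t) / (R - 2 * J)); linarith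

end Cutoff

/-! ### Liouville property on a weighted graph -/

/-- Hölder's inequality with exponents `σ` and `σ / (σ - 1)`, the potential `P` being split as
`P ^ (1 / σ) * P ^ (-(1 / σ)) = 1`. -/
theorem holder_step {V : Type*} {σ : ℝ} (hσ : 1 < σ) (F : Finset V) (μ P w φ : V → ℝ)
    (hμ : ∀ x, 0 < μ x) (hP : ∀ x, 0 < P x) (hw : ∀ x, 0 ≤ w x) (hφ : ∀ x, 0 ≤ φ x) :
    ∑ x ∈ F, μ x * w x * φ x ^ (σ / (σ - 1) - 1) ≤
      (∑ x ∈ F, μ x * P x * w x ^ σ * φ x ^ (σ / (σ - 1))) ^ (1 / σ) *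
      (∑ x ∈ F, μ x * P x ^ (-(1 / (σ - 1)))) ^ (1 / (σ / (σ - 1))) := by
  have hs : 0 < σ - 1 := by linarith
  have h0 : 0 < σ := by linarith
  have hpq : σ.HolderConjugate (σ / (σ - 1)) := Real.HolderConjugate.conjExponent hσ
  have hf : ∀ x, 0 ≤ μ x * P x * w x ^ σ * φ x ^ (σ / (σ - 1)) := fun x =>
    mul_nonneg (mul_nonneg (mul_pos (hμ x) (hP x)).le (Real.rpow_nonneg (hw x) _))
      (Real.rpow_nonneg (hφ x) _)
  have hg : ∀ x, 0 ≤ μ x * P x ^ (-(1 / (σ - 1))) := fun x =>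
    (mul_pos (hμ x) (Real.rpow_pos_of_pos (hP x) _)).le
  have H := Real.inner_le_Lp_mul_Lq_of_nonneg F hpq
    (f := fun x => (μ x * P x * w x ^ σ * φ x ^ (σ / (σ - 1))) ^ (1 / σ))
    (g := fun x => (μ x * P x ^ (-(1 / (σ - 1)))) ^ (1 / (σ / (σ - 1))))
    (fun x _ => Real.rpow_nonneg (hf x) _) (fun x _ => Real.rpow_nonneg (hg x) _)
  have hq : (1 / (σ / (σ - 1))) * (σ / (σ - 1)) = 1 := by field_simp
  have hp : (1 / σ) * σ = 1 := by field_simp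
  simp only [← Real.rpow_mul (hf _), ← Real.rpow_mul (hg _), hp, hq, Real.rpow_one] at H
  refine le_trans (Finset.sum_le_sum fun x _ => le_of_eq ?_) H
  have hm := hμ x
  have hPx := hP x
  rw [Real.mul_rpow (mul_nonneg (mul_pos hm hPx).le (Real.rpow_nonneg (hw x) _))
      (Real.rpow_nonneg (hφ x) _), Real.mul_rpow (mul_pos hm hPx).le (Real.rpow_nonneg (hw x) _),
    Real.mul_rpow hm.le hPx.le, Real.mul_rpow hm.le (Real.rpow_nonneg hPx.le _),
    ← Real.rpow_mul (hw x), ← Real.rpow_mul (hφ x), ← Real.rpow_mul hPx.le]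
  have e1 : σ * (1 / σ) = 1 := by field_simp
  have e2 : σ / (σ - 1) * (1 / σ) = σ / (σ - 1) - 1 := by field_simp; ring
  have e3 : -(1 / (σ - 1)) * (1 / (σ / (σ - 1))) = -(1 / σ) := by field_simp
  rw [e1, e2, e3, Real.rpow_one]
  have e4 : μ x ^ (1 / σ) * μ x ^ (1 / (σ / (σ - 1))) = μ x := by
    rw [← Real.rpow_add hm]
    have : 1 / σ + 1 / (σ / (σ - 1)) = 1 := by field_simp; ring
    rw [this, Real.rpow_one]
  have e5 : P x ^ (1 / σ) * P x ^ (-(1 / σ)) = 1 := by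
    rw [← Real.rpow_add hPx]; simp
  calc μ x * w x * φ x ^ (σ / (σ - 1) - 1)
      = (μ x ^ (1 / σ) * μ x ^ (1 / (σ / (σ - 1)))) * (P x ^ (1 / σ) * P x ^ (-(1 / σ)))
        * (w x * φ x ^ (σ / (σ - 1) - 1)) := by rw [e4, e5]; ring
    _ = _ := by ring

/-- The a priori estimate. Here `B` is the part over the annulus `F` of the sum `A` of
`μ P w ^ σ φ ^ (σ / (σ - 1))`, where `φ` is the cutoff at radius `R`. The factor `1 / R` from the
slope of the cutoff cancels exactly against the growth `R ^ (σ / (σ - 1))` of the annulus, so the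
constant in the last inequality does not depend on `R`. -/
theorem annulus_estimate {V : Type*} (b : V → V → ℝ) (hb : ∀ x y, 0 ≤ b x y)
    (hsymm : ∀ x y, b x y = b y x) (hfin : ∀ x, {y | b x y ≠ 0}.Finite)
    {μ P w d : V → ℝ} (hμ : ∀ x, 0 < μ x) (hP : ∀ x, 0 < P x) (hw : ∀ x, 0 ≤ w x)
    {C J σ R M : ℝ} (hC : ∀ x, ∑ᶠ y, b x y ≤ C * μ x) (hC0 : 0 ≤ C) (hJ : 0 < J)
    (hd : ∀ x y, b x y ≠ 0 → d y ≤ d x + J) (hball : ∀ R, {x | d x < R}.Finite)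
    (hσ : 1 < σ)
    (hsup : ∀ x, ∑ᶠ y, b x y * (w y - w x) + μ x * P x * w x ^ σ ≤ 0)
    (hR : 4 * J ≤ R) (hM0 : 0 ≤ M)
    (hM : ∀ F : Finset V, (∀ x ∈ F, R ≤ d x ∧ d x ≤ 2 * R) →
      ∑ x ∈ F, μ x * P x ^ (-(1 / (σ - 1))) ≤ M * R ^ (σ / (σ - 1)))
    (S : Finset V) (hS : ∀ x ∈ S, d x ≤ R) :
    ∃ (F : Finset V) (A B : ℝ), (∀ x ∈ F, R ≤ d x) ∧ ∑ x ∈ S, μ x * P x * w x ^ σ ≤ A ∧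
      0 ≤ B ∧ B ≤ A ∧ B ≤ ∑ x ∈ F, μ x * P x * w x ^ σ ∧
      A ≤ (σ / (σ - 1) * (2 * J) * C * M ^ (1 / (σ / (σ - 1)))) * B ^ (1 / σ) := by
  classical
  set s := σ / (σ - 1) with hs
  have hσ1 : 0 < σ - 1 := by linarith
  have hs1 : 1 ≤ s := by rw [hs, le_div_iff₀ hσ1]; linarith
  have hRpos : 0 < R := by linarith
  have hRJ : 2 * J < R := by linarith
  set φ : V → ℝ := fun x => cutoff J R (d x) with hφdef
  have hφ0 : ∀ x, 0 ≤ φ x := fun x => cutoff_nonneg _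
  have hφ1 : ∀ x, φ x ≤ 1 := fun x => cutoff_le_one _
  have hψ0 : ∀ x, 0 ≤ φ x ^ s := fun x => Real.rpow_nonneg (hφ0 x) _
  have hψ1 : ∀ x, φ x ^ s ≤ 1 := fun x => Real.rpow_le_one (hφ0 x) (hφ1 x) (by linarith)
  have ha : ∀ x, 0 ≤ μ x * P x * w x ^ σ := fun x =>
    mul_nonneg (mul_pos (hμ x) (hP x)).le (Real.rpow_nonneg (hw x) _)
  set T : Finset V := (hball (2 * R)).toFinset with hTdef
  have hT : ∀ x, x ∈ T ↔ d x < 2 * R := fun x => by simp [hTdef]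
  have hTnbr : ∀ x y, φ x ^ s ≠ 0 → b x y ≠ 0 → y ∈ T := by
    intro x y hx hxy
    rw [hT]
    by_contra! hcon
    have := hd x y hxy
    apply hx
    have : φ x = 0 := cutoff_eq_zero hRJ (by linarith)
    rw [this, Real.zero_rpow (by linarith)]
  set F : Finset V := T.filter (fun x => R ≤ d x) with hFdef
  have hF : ∀ x ∈ F, R ≤ d x ∧ d x ≤ 2 * R := by
    intro x hx
    rw [hFdef, Finset.mem_filter, hT] at hx
    exact ⟨hx.2, hx.1.le⟩
  have hbC : ∀ x, ∑ y ∈ T, b x y ≤ C * μ x := by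
    intro x
    refine le_trans ?_ (hC x)
    rw [finsum_eq_sum_of_support_subset (s := T ∪ (hfin x).toFinset) _
      (fun y hy => by
        simp only [Finset.coe_union, Set.Finite.coe_toFinset]
        exact Or.inr hy)]
    exact Finset.sum_le_sum_of_subset_of_nonneg Finset.subset_union_left fun y _ _ => hb x y
  -- Where the test function does not decrease along the edge, the left-hand side has the good sign,
  -- so the factor `φ x ^ (s - 1)` is obtained at the point `x` itself, also next to the boundary of
  -- the support.
  have hterm : ∀ x y, b x y * (φ x ^ s - φ y ^ s) ≤
      if R ≤ d x then b x y * (s * φ x ^ (s - 1) * (2 * J / R)) else 0 := by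
    intro x y
    rcases eq_or_ne (b x y) 0 with h0 | h0
    · simp [h0]
    have hdxy := hd x y h0
    split_ifs with hx
    · refine mul_le_mul_of_nonneg_left ?_ (hb x y)
      rcases le_total (φ y) (φ x) with hyx | hxy
      · refine (rpow_sub_rpow_le hs1 (hφ0 y) hyx).trans ?_
        refine mul_le_mul_of_nonneg_left (cutoff_sub_le hJ hR hdxy) ?_
        exact mul_nonneg (by linarith) (Real.rpow_nonneg (hφ0 x) _)
      · have h1 : φ x ^ s ≤ φ y ^ s := Real.rpow_le_rpow (hφ0 x) hxy (by linarith)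
        have h2 : 0 ≤ s * φ x ^ (s - 1) * (2 * J / R) :=
          mul_nonneg (mul_nonneg (by linarith) (Real.rpow_nonneg (hφ0 x) _))
            (div_nonneg (by linarith) hRpos.le)
        linarith
    · push Not at hx
      have h1 : φ y = 1 := cutoff_eq_one hRJ (by linarith)
      refine mul_nonpos_of_nonneg_of_nonpos (hb x y) ?_
      rw [h1, Real.one_rpow]
      linarith [hψ1 x]
  have hlap : ∀ x, ∑ y ∈ T, b x y * (φ x ^ s - φ y ^ s) ≤
      if R ≤ d x then s * (2 * J) * C / R * (μ x * φ x ^ (s - 1)) else 0 := by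
    intro x
    refine (Finset.sum_le_sum fun y _ => hterm x y).trans ?_
    split_ifs with hx
    · rw [← Finset.sum_mul]
      refine (mul_le_mul_of_nonneg_right (hbC x) ?_).trans_eq ?_
      · exact mul_nonneg (mul_nonneg (by linarith) (Real.rpow_nonneg (hφ0 x) _))
            (div_nonneg (by linarith) hRpos.le)
      · ring
    · simp
  have key := sum_test_le b hsymm w (fun x => μ x * P x * w x ^ σ) (fun x => φ x ^ s) hψ0 hsup T
    hTnbr
  refine ⟨F, ∑ x ∈ T, μ x * P x * w x ^ σ * φ x ^ s, ∑ x ∈ F, μ x * P x * w x ^ σ * φ x ^ s,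
    fun x hx => (hF x hx).1, ?_, ?_, ?_, ?_, ?_⟩
  · have hST : S ⊆ T := fun x hx => by
      rw [hT]; linarith [hS x hx]
    refine le_trans (Finset.sum_le_sum fun x hx => ?_)
      (Finset.sum_le_sum_of_subset_of_nonneg hST fun x _ _ => mul_nonneg (ha x) (hψ0 x))
    have : φ x = 1 := cutoff_eq_one hRJ (by linarith [hS x hx])
    rw [this, Real.one_rpow, mul_one]
  · exact Finset.sum_nonneg fun x _ => mul_nonneg (ha x) (hψ0 x)
  · exact Finset.sum_le_sum_of_subset_of_nonneg (Finset.filter_subset _ _)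
      fun x _ _ => mul_nonneg (ha x) (hψ0 x)
  · exact Finset.sum_le_sum fun x _ => mul_le_of_le_one_right (ha x) (hψ1 x)
  · set B := ∑ x ∈ F, μ x * P x * w x ^ σ * φ x ^ s with hB
    have hB0 : 0 ≤ B := Finset.sum_nonneg fun x _ => mul_nonneg (ha x) (hψ0 x)
    have hK : 0 ≤ s * (2 * J) * C / R :=
      div_nonneg (mul_nonneg (mul_nonneg (by linarith) (by linarith)) hC0) hRpos.le
    calc ∑ x ∈ T, μ x * P x * w x ^ σ * φ x ^ s
        ≤ ∑ x ∈ T, w x * ∑ y ∈ T, b x y * (φ x ^ s - φ y ^ s) := key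
      _ ≤ ∑ x ∈ T, if R ≤ d x then
            s * (2 * J) * C / R * (μ x * w x * φ x ^ (s - 1)) else 0 := by
          refine Finset.sum_le_sum fun x _ => ?_
          refine (mul_le_mul_of_nonneg_left (hlap x) (hw x)).trans_eq ?_
          split_ifs
          · ring
          · simp
      _ = s * (2 * J) * C / R * ∑ x ∈ F, μ x * w x * φ x ^ (s - 1) := by
          rw [← Finset.sum_filter, Finset.mul_sum]
      _ ≤ s * (2 * J) * C / R * (B ^ (1 / σ) * (M * R ^ s) ^ (1 / s)) := by
          refine mul_le_mul_of_nonneg_left ?_ hK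
          refine (holder_step hσ F μ P w φ hμ hP hw hφ0).trans ?_
          refine mul_le_mul_of_nonneg_left ?_ (Real.rpow_nonneg hB0 _)
          refine Real.rpow_le_rpow ?_ (hM F hF) (by positivity)
          exact Finset.sum_nonneg fun x _ => mul_nonneg (hμ x).le (Real.rpow_nonneg (hP x).le _)
      _ = _ := by
          have : s * (1 / s) = 1 := by field_simp
          rw [Real.mul_rpow hM0 (Real.rpow_nonneg hRpos.le _), ← Real.rpow_mul hRpos.le, this,
            Real.rpow_one]
          field_simp

/-- Liouville property of a weighted graph: by `annulus_estimate`, `μ P w ^ σ` is summable, so its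
sums over distant annuli are small, and the estimate once more shows that it vanishes. -/
theorem eq_zero_of_superharmonic {V : Type*} (b : V → V → ℝ) (hb : ∀ x y, 0 ≤ b x y)
    (hsymm : ∀ x y, b x y = b y x) (hfin : ∀ x, {y | b x y ≠ 0}.Finite)
    {μ P w d : V → ℝ} (hμ : ∀ x, 0 < μ x) (hP : ∀ x, 0 < P x) (hw : ∀ x, 0 ≤ w x)
    {C J σ R₀ M : ℝ} (hC : ∀ x, ∑ᶠ y, b x y ≤ C * μ x) (hC0 : 0 ≤ C) (hJ : 0 < J)
    (hd : ∀ x y, b x y ≠ 0 → d y ≤ d x + J) (hball : ∀ R, {x | d x < R}.Finite)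
    (hσ : 1 < σ)
    (hsup : ∀ x, ∑ᶠ y, b x y * (w y - w x) + μ x * P x * w x ^ σ ≤ 0) (hM0 : 0 ≤ M)
    (hM : ∀ R ≥ R₀, ∀ F : Finset V, (∀ x ∈ F, R ≤ d x ∧ d x ≤ 2 * R) →
      ∑ x ∈ F, μ x * P x ^ (-(1 / (σ - 1))) ≤ M * R ^ (σ / (σ - 1))) (x : V) :
    w x = 0 := by
  classical
  set K := σ / (σ - 1) * (2 * J) * C * M ^ (1 / (σ / (σ - 1))) with hKdef
  set a : V → ℝ := fun x => μ x * P x * w x ^ σ with hadef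
  have hσ1 : 0 < σ - 1 := by linarith
  have hσ0 : 0 < σ := by linarith
  have hK : 0 ≤ K := mul_nonneg (mul_nonneg (mul_nonneg (div_pos hσ0 hσ1).le (by linarith)) hC0)
    (Real.rpow_nonneg hM0 _)
  have ha : ∀ x, 0 ≤ a x := fun x =>
    mul_nonneg (mul_pos (hμ x) (hP x)).le (Real.rpow_nonneg (hw x) _)
  have key : ∀ S : Finset V, ∀ R, max (4 * J) R₀ ≤ R → (∀ x ∈ S, d x ≤ R) →
      ∃ (F : Finset V) (A B : ℝ), (∀ x ∈ F, R ≤ d x) ∧ ∑ x ∈ S, a x ≤ A ∧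
      0 ≤ B ∧ B ≤ A ∧ B ≤ ∑ x ∈ F, a x ∧ A ≤ K * B ^ (1 / σ) := fun S R hR hS =>
    annulus_estimate b hb hsymm hfin hμ hP hw hC hC0 hJ hd hball hσ hsup
      ((le_max_left _ _).trans hR) hM0 (hM R ((le_max_right _ _).trans hR)) S hS
  have hrad : ∀ S : Finset V, ∃ R, max (4 * J) R₀ ≤ R ∧ ∀ x ∈ S, d x < R := by
    intro S
    obtain ⟨m, hm⟩ := (S.image d).exists_le
    refine ⟨max (max (4 * J) R₀) (m + 1), le_max_left _ _, fun x hx => ?_⟩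
    have := hm _ (Finset.mem_image_of_mem d hx)
    linarith [le_max_right (max (4 * J) R₀) (m + 1)]
  -- `B ≤ A` in `A ≤ K * B ^ (1 / σ)` bounds `A` independently of the radius.
  have hsum : Summable a := by
    refine summable_of_sum_le ha (c := K ^ (σ / (σ - 1))) fun S => ?_
    obtain ⟨R, hR, hS⟩ := hrad S
    obtain ⟨F, A, B, -, h1, h2, h3, -, h5⟩ := key S R hR fun x hx => (hS x hx).le
    refine h1.trans ?_
    have hA : 0 ≤ A := h2.trans h3
    rcases hA.eq_or_lt with h0 | hA
    · rw [← h0]; exact Real.rpow_nonneg hK _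
    have h6 : A ≤ K * A ^ (1 / σ) :=
      h5.trans (mul_le_mul_of_nonneg_left (Real.rpow_le_rpow h2 h3 (by positivity)) hK)
    have h7 : A ^ (1 - 1 / σ) ≤ K := by
      rw [Real.rpow_sub hA, Real.rpow_one, div_le_iff₀ (Real.rpow_pos_of_pos hA _)]
      exact h6
    have h8 := Real.rpow_le_rpow (Real.rpow_nonneg hA.le _) h7 (div_pos hσ0 hσ1).le
    rw [← Real.rpow_mul hA.le] at h8
    have : (1 - 1 / σ) * (σ / (σ - 1)) = 1 := by field_simp
    rwa [this, Real.rpow_one] at h8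
  -- `B` is bounded by a tail of the convergent series.
  have hsmall : ∀ ε > 0, a x ≤ K * ε ^ (1 / σ) := by
    intro ε hε
    obtain ⟨S, hS⟩ := summable_iff_vanishing_norm.1 hsum ε hε
    obtain ⟨R, hR, hSR⟩ := hrad (insert x S)
    obtain ⟨F, A, B, hF, h1, h2, -, h4, h5⟩ := key {x} R hR fun y hy => by
      rw [Finset.mem_singleton.1 hy]; exact (hSR x (Finset.mem_insert_self _ _)).le
    have hdisj : Disjoint F S := Finset.disjoint_left.2 fun y hyF hyS =>
      absurd (hSR y (Finset.mem_insert_of_mem hyS)) (not_lt.2 (hF y hyF))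
    have h6 : B ≤ ε := h4.trans ((le_abs_self _).trans (hS F hdisj).le)
    rw [Finset.sum_singleton] at h1
    exact h1.trans (h5.trans
      (mul_le_mul_of_nonneg_left (Real.rpow_le_rpow h2 h6 (by positivity)) hK))
  have hlim : Tendsto (fun ε : ℝ => K * ε ^ (1 / σ)) (nhdsWithin 0 (Ioi 0)) (nhds 0) := by
    have h1 : ContinuousAt (fun ε : ℝ => K * ε ^ (1 / σ)) 0 :=
      continuousAt_const.mul (Real.continuousAt_rpow_const _ _ (Or.inr (by positivity)))
    have h2 := h1.tendsto
    rw [Real.zero_rpow (by positivity), mul_zero] at h2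
    exact h2.mono_left nhdsWithin_le_nhds
  have hax : a x ≤ 0 := ge_of_tendsto hlim (eventually_nhdsWithin_of_forall fun ε hε => hsmall ε hε)
  have hax0 : w x ^ σ = 0 := by
    have := le_antisymm hax (ha x)
    exact (mul_eq_zero.1 this).resolve_left (mul_pos (hμ x) (hP x)).ne'
  exact (Real.rpow_eq_zero (hw x) hσ0.ne').1 hax0

/-! ### Concave functions on an interval -/

theorem concaveOn_Icc_of_deriv_deriv_nonpos {g : ℝ → ℝ} {l : ℝ} (h1 : ContDiffOn ℝ 1 g (Icc 0 l))
    (h2 : ContDiffOn ℝ 2 g (Ioo 0 l)) (hg : ∀ t ∈ Ioo 0 l, deriv (deriv g) t ≤ 0) :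
    ConcaveOn ℝ (Icc 0 l) g := by
  refine concaveOn_of_deriv2_nonpos (convex_Icc 0 l) h1.continuousOn ?_ ?_ ?_
  · rw [interior_Icc]; exact h2.differentiableOn (by norm_num)
  · rw [interior_Icc]
    exact ((contDiffOn_succ_iff_deriv_of_isOpen (n := 1) isOpen_Ioo).1 h2).2.2.differentiableOn
      (by norm_num)
  · rw [interior_Icc]; exact hg

/-! ### Points and distances on a metric graph -/

namespace MetricGraph

variable {V E : Type*} (G : MetricGraph V E)

theorem pt_zero (e : E) : G.pt e 0 = Point.vertex (G.init e) := by
  simp [pt]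

theorem pt_len (e : E) : G.pt e (G.len e) = Point.vertex (G.final e) := by
  simp [pt, (G.len_pos e).not_ge]

theorem pt_of_mem (e : E) (t : Ioo (0 : ℝ) (G.len e)) : G.pt e t = Point.inner e t := by
  have ht : (t : ℝ) ∈ Ioo (0 : ℝ) (G.len e) := t.2
  rw [pt, dif_pos ht]

variable {G}

theorem IsPath.nonneg {x y : G.Point} {L : ℝ} (h : G.IsPath x y L) : 0 ≤ L := by
  induction h with
  | nil => exact le_rfl
  | cons e s t _ _ y L _ ih => exact add_nonneg (abs_nonneg _) ih

theorem dist_vertex_le_of_adj (hconn : G.IsConnected) {x y : V} (z : V) {J : ℝ}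
    (hJ : ∀ e, G.len e ≤ J) (hxy : G.Adj x y) :
    G.dist (Point.vertex y) (Point.vertex z) ≤ G.dist (Point.vertex x) (Point.vertex z) + J := by
  have hne : {L : ℝ | G.IsPath (Point.vertex x) (Point.vertex z) L}.Nonempty := by
    rcases eq_or_ne x z with rfl | h
    · exact ⟨0, IsPath.nil _⟩
    · exact hconn x z h
  rw [← sub_le_iff_le_add]
  refine le_csInf hne fun L hL => ?_
  obtain ⟨e, he⟩ := hxy
  have h0 : (0 : ℝ) ∈ Icc 0 (G.len e) := left_mem_Icc.2 (G.len_pos e).le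
  have h1 : G.len e ∈ Icc 0 (G.len e) := right_mem_Icc.2 (G.len_pos e).le
  have hpath : G.IsPath (Point.vertex y) (Point.vertex z) (G.len e + L) := by
    rcases he with ⟨rfl, rfl⟩ | ⟨rfl, rfl⟩
    · rw [← G.pt_zero] at hL
      have := IsPath.cons e _ _ h1 h0 _ _ hL
      rwa [G.pt_len, sub_zero, abs_of_pos (G.len_pos e)] at this
    · rw [← G.pt_len] at hL
      have := IsPath.cons e _ _ h0 h1 _ _ hL
      rwa [G.pt_zero, zero_sub, abs_neg, abs_of_pos (G.len_pos e)] at this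
  have : G.dist (Point.vertex y) (Point.vertex z) ≤ G.len e + L :=
    csInf_le ⟨0, fun _ h => h.nonneg⟩ hpath
  linarith [hJ e]

theorem IsLocallyFinite.finite_adj (h : G.IsLocallyFinite) (x : V) : {y | G.Adj x y}.Finite := by
  refine (((h x).image G.init).union ((h x).image G.final)).subset ?_
  rintro y ⟨e, ⟨hx, hy⟩ | ⟨hy, hx⟩⟩
  · exact Or.inr ⟨e, Or.inl hx, hy⟩
  · exact Or.inl ⟨e, Or.inr hx, hy⟩

theorem Adj.symm {x y : V} (h : G.Adj x y) : G.Adj y x := by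
  obtain ⟨e, he⟩ := h
  exact ⟨e, he.symm⟩

end MetricGraph

/-! ### Vanishing of solutions on vertices and edges -/

namespace WeightedMetricGraph

open MetricGraph

variable {V E : Type*} {G : WeightedMetricGraph V E}

theorem IsSolution.vertex_eq_zero {x₀ : V} (hG : G.StandingHyp x₀) {σ : ℝ} (hσ : 1 < σ)
    {P : G.Point → ℝ} (hP : ∀ x, 0 < P x) {C R₀ : ℝ} (hC : 0 ≤ C) (hR₀ : 0 ≤ R₀)
    (hgrowth : ∀ R ≥ R₀, (∑' v : {v : V // Point.vertex v ∈ G.annulus x₀ R},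
          ENNReal.ofReal (G.μ v * P (Point.vertex v) ^ (-(1 / (σ - 1)))))
        ≤ ENNReal.ofReal (C * R ^ (σ / (σ - 1))))
    {u : G.Point → ℝ} (hu : G.IsSolution P σ u) (hu_nonneg : ∀ x, 0 ≤ u x) (v : V) :
    u (Point.vertex v) = 0 := by
  classical
  obtain ⟨D, hD, hweight⟩ := hG.weight_le
  -- `ω` is arbitrary off adjacent pairs, so it is cut off there.
  let b : V → V → ℝ := fun x y => if G.Adj x y then G.ω x y else 0
  have hbfin : ∀ (x : V) (f : V → ℝ),
      ∑ᶠ y ∈ {y | G.Adj x y}, G.ω x y * f y = ∑ᶠ y, b x y * f y := by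
    intro x f
    rw [finsum_mem_def]
    refine finsum_congr fun y => ?_
    by_cases h : G.Adj x y <;> simp [b, h]
  have hadj : ∀ {x y : V}, b x y ≠ 0 → G.Adj x y := fun {x y} h => by
    by_contra h'
    exact h (if_neg h')
  refine eq_zero_of_superharmonic b (fun x y => ?_) (fun x y => ?_)
    (fun x => (hG.locallyFinite.finite_adj x).subset fun y hy => hadj hy)
    (μ := G.μ) (P := fun x => P (Point.vertex x)) (w := fun x => u (Point.vertex x))
    (d := fun x => G.dist (Point.vertex x) (Point.vertex x₀)) (C := D)
    (J := max (⨆ e, G.len e) 1) (σ := σ) (R₀ := R₀) (M := C)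
    G.μ_pos (fun x => hP _) (fun x => hu_nonneg _) (fun x => ?_) hD.le (by positivity)
    (fun x y hxy => dist_vertex_le_of_adj hG.connected x₀
      (fun e => (le_ciSup hG.len_bddAbove e).trans (le_max_left _ _)) (hadj hxy))
    (fun R => (hG.ball_vertices_finite (max R 1) (by positivity)).subset
      fun x (hx : _ < R) => hx.trans_le (le_max_left R 1)) hσ (fun x => ?_) hC (fun R hR F hF => ?_) v
  · by_cases h : G.Adj x y
    · simpa [b, h] using (G.ω_pos x y h).le
    · simp [b, h]
  · by_cases h : G.Adj x y
    · simpa [b, h, h.symm] using G.ω_symm x y h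
    · have h' : ¬ G.Adj y x := fun h' => h h'.symm
      simp [b, h, h']
  · have := hweight x
    have h1 := hbfin x fun _ => 1
    simp only [mul_one] at h1
    rwa [h1] at this
  · have h := hu.vertex_le x
    have hμ := G.μ_pos x
    rw [vertexLaplacian, hbfin x fun y => u (Point.vertex y) - u (Point.vertex x),
      abs_of_nonneg (hu_nonneg _)] at h
    have h2 := mul_nonpos_of_nonneg_of_nonpos hμ.le h
    rw [mul_add, ← mul_assoc, mul_one_div_cancel hμ.ne', one_mul, ← mul_assoc] at h2
    exact h2
  · have hnn : ∀ x, 0 ≤ G.μ x * P (Point.vertex x) ^ (-(1 / (σ - 1))) := fun x =>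
      mul_nonneg (G.μ_pos x).le (Real.rpow_nonneg (hP _).le _)
    have hbound : 0 ≤ C * R ^ (σ / (σ - 1)) :=
      mul_nonneg hC (Real.rpow_nonneg (hR₀.trans hR) _)
    rw [← ENNReal.ofReal_le_ofReal_iff hbound, ENNReal.ofReal_sum_of_nonneg fun x _ => hnn x]
    refine le_trans ?_ (hgrowth R hR)
    rw [← Finset.sum_subtype_of_mem (p := fun x => Point.vertex x ∈ G.annulus x₀ R)
      (fun x => ENNReal.ofReal (G.μ x * P (Point.vertex x) ^ (-(1 / (σ - 1)))))
      (fun x hx => hF x hx)]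
    exact ENNReal.sum_le_tsum _

theorem IsSolution.concaveOn_onEdge {σ : ℝ} {P : G.Point → ℝ} (hP : ∀ x, 0 < P x)
    {u : G.Point → ℝ} (hu : G.IsSolution P σ u) (e : E) :
    ConcaveOn ℝ (Icc 0 (G.len e)) (G.onEdge u e) := by
  refine concaveOn_Icc_of_deriv_deriv_nonpos (hu.memD.contDiffOn_one e) (hu.memD.contDiffOn_two e)
    fun t ht => ?_
  have h1 := hu.edge_le e t ht
  have h2 : 0 ≤ G.onEdge P e t * |G.onEdge u e t| ^ σ :=
    mul_nonneg (hP _).le (Real.rpow_nonneg (abs_nonneg _) _)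
  linarith

/-- A concave function vanishing at both ends of an edge has nonpositive outer derivatives. -/
theorem IsSolution.outerNormalDeriv_nonpos {σ : ℝ} {P : G.Point → ℝ} (hP : ∀ x, 0 < P x)
    {u : G.Point → ℝ} (hu : G.IsSolution P σ u) (hv : ∀ v, u (Point.vertex v) = 0) (e : E) (v : V) :
    G.outerNormalDeriv u e v ≤ 0 := by
  have hl := G.len_pos e
  have hc := hu.concaveOn_onEdge hP e
  have hdiff := (hu.memD.contDiffOn_one e).differentiableOn (by norm_num)
  have h0 := left_mem_Icc.2 hl.le
  have h1 := right_mem_Icc.2 hl.le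
  have hslope : slope (G.onEdge u e) 0 (G.len e) = 0 := by
    simp [slope, onEdge, pt_zero, pt_len, hv]
  unfold outerNormalDeriv
  split_ifs
  · exact (hc.derivWithin_le_slope h0 h1 hl (hdiff _ h1)).trans_eq hslope
  · exact neg_nonpos.2 (hslope.ge.trans (hc.slope_le_derivWithin h0 h1 hl (hdiff _ h0)))
  · exact le_rfl

theorem IsSolution.onEdge_eq_zero (hfin : G.IsLocallyFinite) (hloop : ∀ e, G.init e ≠ G.final e)
    {σ : ℝ} {P : G.Point → ℝ} (hP : ∀ x, 0 < P x) {u : G.Point → ℝ} (hu : G.IsSolution P σ u)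
    (hu_nonneg : ∀ x, 0 ≤ u x) (hv : ∀ v, u (Point.vertex v) = 0) (e : E) {t : ℝ}
    (ht : t ∈ Ioo 0 (G.len e)) : G.onEdge u e t = 0 := by
  have hl := G.len_pos e
  have h0 := left_mem_Icc.2 hl.le
  have hdiff := (hu.memD.contDiffOn_one e).differentiableOn (by norm_num)
  have hK := hu.kirchhoff_eq (G.init e)
  rw [kirchhoff, finsum_mem_eq_finite_toFinset_sum _ (hfin _)] at hK
  have hmem : e ∈ (hfin (G.init e)).toFinset := by simp [Incident]
  have hzero := (Finset.sum_eq_zero_iff_of_nonpos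
    fun e' _ => hu.outerNormalDeriv_nonpos hP hv e' (G.init e)).1 hK e hmem
  rw [outerNormalDeriv, if_neg (hloop e).symm, if_pos rfl, neg_eq_zero] at hzero
  have hs := (hu.concaveOn_onEdge hP e).slope_le_derivWithin h0 (Ioo_subset_Icc_self ht) ht.1
    (hdiff _ h0)
  have hg0 : G.onEdge u e 0 = 0 := by rw [onEdge, pt_zero, hv]
  rw [hzero, slope_def_field, hg0, sub_zero, sub_zero, div_le_iff₀ ht.1, zero_mul] at hs
  exact le_antisymm hs (hu_nonneg _)

end WeightedMetricGraph

theorem theorem3p1 {V E : Type*} [Countable V] [Countable E]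
    (G : WeightedMetricGraph V E) (x₀ : V) (hG : G.StandingHyp x₀)
    (σ : ℝ) (hσ : 1 < σ)
    (P : G.Point → ℝ) (hP : ∀ x, 0 < P x)
    (hPmeas : ∀ e, AEMeasurable (G.onEdge P e) (volume.restrict (Ioo 0 (G.len e))))
    (hgrowth : ∃ C > 0, ∀ R ≥ max (2 * ⨆ e, G.len e) 1,
      (∑' v : {v : V // MetricGraph.Point.vertex v ∈ G.annulus x₀ R},
          ENNReal.ofReal (G.μ v * P (MetricGraph.Point.vertex v) ^ (-(1 / (σ - 1)))))
        ≤ ENNReal.ofReal (C * R ^ (σ / (σ - 1))) ∧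
      (∑' e : {e : E // ∀ t, MetricGraph.Point.inner e t ∈ G.annulus x₀ R},
          ∫⁻ t in Ioo 0 (G.len e), ENNReal.ofReal (G.onEdge P e t ^ (-(1 / (σ - 1)))))
        ≤ ENNReal.ofReal (C * R ^ (σ / (σ - 1))))
    (u : G.Point → ℝ) (hu : G.IsSolution P σ u) (hu_nonneg : ∀ x, 0 ≤ u x) :
    ∀ x, u x = 0 := by
  obtain ⟨C, hC, hgrowth⟩ := hgrowth
  have hv : ∀ v, u (MetricGraph.Point.vertex v) = 0 :=
    hu.vertex_eq_zero hG hσ hP hC.le (zero_le_one.trans (le_max_right _ _))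
      (fun R hR => (hgrowth R hR).1) hu_nonneg
  rintro (v | ⟨e, t⟩)
  · exact hv v
  · rw [← MetricGraph.pt_of_mem]
    exact hu.onEdge_eq_zero hG.locallyFinite hG.no_loops hP hu_nonneg hv e t.2
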